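/- Let $M$ be a connected smooth (Hausdorff) manifold without boundary, of dimension $n>1$, and let $\mu$ be a volume form on $M$, i.e. a smooth nowhere vanishing $n$-form. Let $\mathfrak X(M)$ be the Lie algebra of smooth vector fields on $M$, and let $$\mathfrak X(M,[\mu]) := \{X\in\mathfrak X(M) : \text{there is a constant } \lambda\in\mathbb R \text{ with } L_X\mu=\lambda\mu\}.$$ Then there does not exist a Lie subalgebra $\mathfrak g\subseteq\mathfrak X(M)$ such that $\mathfrak X(M,[\mu])\subsetneq\mathfrak g$ and $\mathfrak X(M,[\mu])$ has finite codimension in $\mathfrak g$, i.e. $\dim_{\mathbb R}\bigl(\mathfrak g/\mathfrak X(M,[\mu])\bigr)<\infty$. -/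

import Mathlib

open scoped Manifold ContDiff

/-! ### The Lie algebra of smooth vector fields -/

/-- Smooth vector fields on a smooth `n`-dimensional manifold `M` (without boundary), as smooth
sections of the tangent bundle. -/
abbrev SmoothVectorField (n : ℕ) (M : Type*) [TopologicalSpace M]
    [ChartedSpace (EuclideanSpace ℝ (Fin n)) M] [IsManifold (𝓡 n) ∞ M] : Type _ :=
  ContMDiffSection (𝓡 n) (EuclideanSpace ℝ (Fin n)) ∞ (fun x : M => TangentSpace (𝓡 n) x)

namespace SmoothVectorField

variable {n : ℕ} {M : Type*} [TopologicalSpace M]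
  [ChartedSpace (EuclideanSpace ℝ (Fin n)) M] [IsManifold (𝓡 n) ∞ M]

theorem natCast_le_infty (k : ℕ) : (k : WithTop ℕ∞) ≤ ∞ := by
  exact_mod_cast (le_top : (k : ℕ∞) ≤ ⊤)

variable (n M) in
theorem isManifold_of_infty (k : ℕ) : IsManifold (𝓡 n) (k : WithTop ℕ∞) M :=
  IsManifold.of_le (n := ∞) (natCast_le_infty k)

theorem contMDiff_mlieBracket (X Y : SmoothVectorField n M) :
    ContMDiff (𝓡 n) ((𝓡 n).prod 𝓘(ℝ, EuclideanSpace ℝ (Fin n))) ∞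
      (fun x => (⟨x, VectorField.mlieBracket (𝓡 n) X Y x⟩ : TangentBundle (𝓡 n) M)) := by
  have : IsManifold (𝓡 n) (((⊤ : ℕ∞) : WithTop ℕ∞) + 1) M := by
    change IsManifold (𝓡 n) ∞ M
    infer_instance
  have : IsManifold (𝓡 n) (minSmoothness ℝ 2) M := by
    simpa using isManifold_of_infty n M 2
  exact ContDiff.mlieBracket_vectorField (m := ⊤) (n := ⊤) X.contMDiff Y.contMDiff (by simp)

/-- The usual Lie bracket of vector fields. -/
noncomputable instance instBracket : Bracket (SmoothVectorField n M) (SmoothVectorField n M) where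
  bracket X Y := ⟨fun x => VectorField.mlieBracket (𝓡 n) X Y x, contMDiff_mlieBracket X Y⟩

theorem bracket_apply (X Y : SmoothVectorField n M) (x : M) :
    ⁅X, Y⁆ x = VectorField.mlieBracket (𝓡 n) X Y x := rfl

theorem coe_bracket (X Y : SmoothVectorField n M) :
    ⇑⁅X, Y⁆ = VectorField.mlieBracket (𝓡 n) X Y := rfl

theorem mdiffAt (X : SmoothVectorField n M) (x : M) :
    MDifferentiableAt (𝓡 n) ((𝓡 n).prod 𝓘(ℝ, EuclideanSpace ℝ (Fin n)))
      (fun y => (⟨y, X y⟩ : TangentBundle (𝓡 n) M)) x :=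
  X.contMDiff.contMDiffAt.mdifferentiableAt (by simp)

noncomputable instance instLieRing : LieRing (SmoothVectorField n M) where
  add_lie X Y Z := by
    have := isManifold_of_infty n M 2
    ext1 x
    rw [ContMDiffSection.coe_add, Pi.add_apply, bracket_apply, bracket_apply, bracket_apply,
      ContMDiffSection.coe_add]
    exact VectorField.mlieBracket_add_left (X.mdiffAt x) (Y.mdiffAt x)
  lie_add X Y Z := by
    have := isManifold_of_infty n M 2
    ext1 x
    rw [ContMDiffSection.coe_add, Pi.add_apply, bracket_apply, bracket_apply, bracket_apply,
      ContMDiffSection.coe_add]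
    exact VectorField.mlieBracket_add_right (Y.mdiffAt x) (Z.mdiffAt x)
  lie_self X := by
    ext1 x
    rw [bracket_apply, VectorField.mlieBracket_self]
    rfl
  leibniz_lie X Y Z := by
    have : IsManifold (𝓡 n) (minSmoothness ℝ 3) M := by
      simpa using isManifold_of_infty n M 3
    have h : ∀ W : SmoothVectorField n M, ContMDiff (𝓡 n)
        ((𝓡 n).prod 𝓘(ℝ, EuclideanSpace ℝ (Fin n))) (minSmoothness ℝ 2)
        (fun x => (⟨x, W x⟩ : TangentBundle (𝓡 n) M)) := fun W =>
      W.contMDiff.of_le (by simpa using natCast_le_infty 2)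
    ext1 x
    rw [ContMDiffSection.coe_add, Pi.add_apply, bracket_apply, bracket_apply, bracket_apply,
      coe_bracket, coe_bracket, coe_bracket]
    exact VectorField.leibniz_identity_mlieBracket_apply (h X x) (h Y x) (h Z x)

noncomputable instance instLieAlgebra : LieAlgebra ℝ (SmoothVectorField n M) where
  lie_smul c X Y := by
    have := isManifold_of_infty n M 2
    ext1 x
    rw [ContMDiffSection.coe_smul, Pi.smul_apply, bracket_apply, bracket_apply,
      ContMDiffSection.coe_smul]
    exact VectorField.mlieBracket_const_smul_right (Y.mdiffAt x)

end SmoothVectorField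

/-! ### Lie derivatives of differential forms -/

section ModelSpace

variable {E : Type*} [NormedAddCommGroup E] [NormedSpace ℝ E] {k : ℕ}

/-- The Lie derivative `L_X η` of a `k`-form `η` along a vector field `X` on a normed space; see
`flatLieDeriv_apply` for the formula. -/
noncomputable def flatLieDeriv (X : E → E) (η : E → E [⋀^Fin k]→L[ℝ] ℝ) (y : E) :
    E [⋀^Fin k]→L[ℝ] ℝ :=
  fderiv ℝ η y (X y) +
    (η y).fderivCompContinuousLinearMap (ContinuousLinearMap.id ℝ E) (fderiv ℝ X y)

/-- `(L_X η)(v₁, …, v_k) = (D_X η)(v₁, …, v_k) + ∑ᵢ η(v₁, …, DX(vᵢ), …, v_k)`. -/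
theorem flatLieDeriv_apply (X : E → E) (η : E → E [⋀^Fin k]→L[ℝ] ℝ) (y : E) (v : Fin k → E) :
    flatLieDeriv X η y v = fderiv ℝ η y (X y) v +
      ∑ i, η y (Function.update v i (fderiv ℝ X y (v i))) := by
  simp only [flatLieDeriv, ContinuousAlternatingMap.add_apply,
    ContinuousAlternatingMap.fderivCompContinuousLinearMap_apply]
  congr 1
  refine Finset.sum_congr rfl fun i _ => congrArg (η y) (funext fun j => ?_)
  by_cases h : j = i
  · subst h
    simp
  · simp [Function.update_of_ne h]

theorem flatLieDeriv_add {X Y : E → E} (η : E → E [⋀^Fin k]→L[ℝ] ℝ) {y : E}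
    (hX : DifferentiableAt ℝ X y) (hY : DifferentiableAt ℝ Y y) :
    flatLieDeriv (X + Y) η y = flatLieDeriv X η y + flatLieDeriv Y η y := by
  simp only [flatLieDeriv, fderiv_add hX hY, Pi.add_apply, map_add]
  abel

theorem flatLieDeriv_const_smul (c : ℝ) (X : E → E) (η : E → E [⋀^Fin k]→L[ℝ] ℝ) {y : E} :
    flatLieDeriv (c • X) η y = c • flatLieDeriv X η y := by
  simp only [flatLieDeriv, fderiv_const_smul_field, Pi.smul_apply, map_smul, smul_add]

end ModelSpace

section Manifold

variable {n : ℕ} {M : Type*} [TopologicalSpace M] [ChartedSpace (EuclideanSpace ℝ (Fin n)) M]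

/-- The coordinate expression, in the preferred chart at `x₀`, of a (not necessarily smooth)
`k`-form on `M`: its pullback along the inverse of the chart. -/
noncomputable def formInChart {k : ℕ} (η : ∀ x : M, TangentSpace (𝓡 n) x [⋀^Fin k]→L[ℝ] ℝ)
    (x₀ : M) (y : EuclideanSpace ℝ (Fin n)) : EuclideanSpace ℝ (Fin n) [⋀^Fin k]→L[ℝ] ℝ :=
  (η ((extChartAt (𝓡 n) x₀).symm y)).compContinuousLinearMap
    (mfderiv 𝓘(ℝ, EuclideanSpace ℝ (Fin n)) (𝓡 n) (extChartAt (𝓡 n) x₀).symm y)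

/-- The coordinate expression of a vector field in the preferred chart at `x₀`. -/
noncomputable def fieldInChart (X : ∀ x : M, TangentSpace (𝓡 n) x) (x₀ : M) :
    EuclideanSpace ℝ (Fin n) → EuclideanSpace ℝ (Fin n) :=
  VectorField.mpullback 𝓘(ℝ, EuclideanSpace ℝ (Fin n)) (𝓡 n) (extChartAt (𝓡 n) x₀).symm X

/-- The Lie derivative `L_X η` of a `k`-form `η` along a vector field `X` on `M`, computed at `x`
in the preferred chart at `x`. -/
noncomputable def lieDeriv {k : ℕ} (X : ∀ x : M, TangentSpace (𝓡 n) x)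
    (η : ∀ x : M, TangentSpace (𝓡 n) x [⋀^Fin k]→L[ℝ] ℝ) (x : M) :
    TangentSpace (𝓡 n) x [⋀^Fin k]→L[ℝ] ℝ :=
  ContinuousAlternatingMap.compContinuousLinearMap
    (flatLieDeriv (fieldInChart X x) (formInChart η x) (extChartAt (𝓡 n) x x))
    (mfderiv (𝓡 n) 𝓘(ℝ, EuclideanSpace ℝ (Fin n)) (extChartAt (𝓡 n) x) x)

end Manifold

/-- A volume form on an `n`-dimensional manifold: a smooth, nowhere vanishing `n`-form. -/
structure VolumeForm (n : ℕ) (M : Type*) [TopologicalSpace M]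
    [ChartedSpace (EuclideanSpace ℝ (Fin n)) M] where
  /-- The underlying `n`-form. -/
  form : ∀ x : M, TangentSpace (𝓡 n) x [⋀^Fin n]→L[ℝ] ℝ
  smooth : ∀ x₀ : M, ContDiffOn ℝ ∞ (formInChart form x₀) (extChartAt (𝓡 n) x₀).target
  ne_zero : ∀ x : M, form x ≠ 0

section Conformal

variable {n : ℕ} {M : Type*} [TopologicalSpace M]
  [ChartedSpace (EuclideanSpace ℝ (Fin n)) M] [IsManifold (𝓡 n) ∞ M]

theorem SmoothVectorField.differentiableAt_fieldInChart (X : SmoothVectorField n M) (x : M) :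
    DifferentiableAt ℝ (fieldInChart X x) (extChartAt (𝓡 n) x x) := by
  have := SmoothVectorField.isManifold_of_infty n M 2
  have h := (X.mdiffAt x).mdifferentiableWithinAt (s := Set.univ)
    |>.differentiableWithinAt_mpullbackWithin_vectorField
  have hr : Set.range (𝓡 n) = Set.univ := by simp
  rw [hr, Set.preimage_univ, Set.inter_univ, VectorField.mpullbackWithin_univ] at h
  exact h.differentiableAt Filter.univ_mem

theorem lieDeriv_add {k : ℕ} (X Y : SmoothVectorField n M)
    (η : ∀ x : M, TangentSpace (𝓡 n) x [⋀^Fin k]→L[ℝ] ℝ) (x : M) :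
    lieDeriv ⇑(X + Y) η x = lieDeriv ⇑X η x + lieDeriv ⇑Y η x := by
  have h : fieldInChart ⇑(X + Y) x = fieldInChart ⇑X x + fieldInChart ⇑Y x := by
    rw [ContMDiffSection.coe_add]
    exact VectorField.mpullback_add
  unfold lieDeriv
  rw [h, flatLieDeriv_add _ (X.differentiableAt_fieldInChart x)
    (Y.differentiableAt_fieldInChart x)]
  rfl

theorem lieDeriv_smul {k : ℕ} (c : ℝ) (X : SmoothVectorField n M)
    (η : ∀ x : M, TangentSpace (𝓡 n) x [⋀^Fin k]→L[ℝ] ℝ) (x : M) :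
    lieDeriv ⇑(c • X) η x = c • lieDeriv ⇑X η x := by
  have h : fieldInChart ⇑(c • X) x = c • fieldInChart ⇑X x := by
    rw [ContMDiffSection.coe_smul]
    exact VectorField.mpullback_const_smul
  unfold lieDeriv
  rw [h, flatLieDeriv_const_smul]
  rfl

/-- The space `𝔛(M, [μ])` of all smooth vector fields `X` on `M` such that `L_X μ = λ μ` for some
constant `λ ∈ ℝ`. -/
noncomputable def conformalFields (μ : VolumeForm n M) : Submodule ℝ (SmoothVectorField n M) where
  carrier := {X | ∃ c : ℝ, ∀ x : M, lieDeriv X μ.form x = c • μ.form x}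
  add_mem' := by
    rintro X Y ⟨a, ha⟩ ⟨b, hb⟩
    exact ⟨a + b, fun x => by rw [lieDeriv_add, ha, hb, add_smul]⟩
  zero_mem' := by
    refine ⟨0, fun x => ?_⟩
    have h := lieDeriv_smul (0 : ℝ) (0 : SmoothVectorField n M) μ.form x
    rw [zero_smul, zero_smul] at h
    rw [h, zero_smul]
  smul_mem' := by
    rintro c X ⟨a, ha⟩
    exact ⟨c * a, fun x => by rw [lieDeriv_smul, ha, mul_smul]⟩

end Conformal

/-!
Write `div X` for the function with `L_X μ = (div X) μ`, so that `X` is conformal exactly when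
`div X` is constant. Commutation of the Lie derivative with brackets becomes the cocycle identity
`div [X, Y] = X (div Y) - Y (div X)`, hence `div [X, Y] = X (div Y)` when `div X = 0`.

If `Y` is not conformal, then `div Y` is not constant, so it has infinitely many noncritical points,
and one can choose a sequence `p i` of them with open neighbourhoods `U i` such that `p j ∈ U i`
only for `i = j`. In dimension at least two there are fields without divergence that are supported
in a given open set and have a prescribed value at a given point: in a chart, divide a compactly
supported Hamiltonian field by the density of `μ`. So there are `X i` with `div (X i) = 0`,
supported in `U i`, with `X i (div Y) ≠ 0` at `p i`. The functions `div [X i, Y] = X i (div Y)` are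
then linearly independent modulo constants, so the brackets `[X i, Y]` are linearly independent
modulo conformal fields.
-/

section LinearAlgebra

theorem sum_map_update_basis_eq_trace_mul {R V ι : Type*} [CommRing R] [AddCommGroup V]
    [Module R V] [Fintype ι] [DecidableEq ι] (b : Module.Basis ι R V) (η : V [⋀^ι]→ₗ[R] R)
    (A : V →ₗ[R] V) :
    ∑ i, η (Function.update b i (A (b i))) = LinearMap.trace R V A * η b := by
  rw [LinearMap.trace_eq_matrix_trace R b, Matrix.trace, Finset.sum_mul]
  refine Finset.sum_congr rfl fun i _ => ?_
  calc η (Function.update b i (A (b i)))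
      = ∑ j, b.repr (A (b i)) j * η (Function.update b i (b j)) := by
        conv_lhs => rw [← b.sum_repr (A (b i)), η.map_update_sum]
        simp only [η.map_update_smul, smul_eq_mul]
    _ = b.repr (A (b i)) i * η b := by
        rw [Finset.sum_eq_single_of_mem i (Finset.mem_univ i), Function.update_eq_self]
        exact fun j _ hji => by rw [η.map_update_self _ hji.symm, mul_zero]
    _ = _ := by rw [Matrix.diag_apply, LinearMap.toMatrix_apply]

/-- Evaluating a linear relation modulo `S` at an index outside its finite support shows that the
constant it equals is `0`; evaluating at the other indices then isolates the coefficients. -/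
theorem linearIndependent_mkQ_of_apply_ne_zero_iff {R V ι : Type*} [Ring R] [NoZeroDivisors R]
    [AddCommGroup V] [Module R V] [Infinite ι] {S : Submodule R V} (D : V →ₗ[R] ι → R)
    (hS : ∀ s ∈ S, ∀ i j, D s i = D s j) {v : ι → V} (hv : ∀ i j, D (v i) j ≠ 0 ↔ i = j) :
    LinearIndependent R fun i => S.mkQ (v i) := by
  classical
  refine linearIndependent_iff'.2 fun s c hc i hi => ?_
  have hmem : ∑ k ∈ s, c k • v k ∈ S := by
    rw [← Submodule.ker_mkQ S, LinearMap.mem_ker, map_sum]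
    simpa only [map_smul] using hc
  have hD (j : ι) : D (∑ k ∈ s, c k • v k) j = if j ∈ s then c j * D (v j) j else 0 := by
    have hterm (k : ι) : c k * D (v k) j = if j = k then c j * D (v j) j else 0 := by
      split_ifs with h
      · rw [h]
      · rw [not_not.1 (mt (hv k j).1 (Ne.symm h)), mul_zero]
    simp only [map_sum, map_smul, Finset.sum_apply, Pi.smul_apply, smul_eq_mul]
    rw [Finset.sum_congr rfl fun k _ => hterm k, Finset.sum_ite_eq]
  obtain ⟨j, hj⟩ := Infinite.exists_notMem_finset s
  have hzero : c i * D (v i) i = 0 := by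
    have := hS _ hmem i j
    rwa [hD, hD, if_pos hi, if_neg hj] at this
  exact (mul_eq_zero.1 hzero).resolve_right ((hv i i).2 rfl)

end LinearAlgebra

section FlatLieDerivative

open Filter Topology

variable {E F : Type*} [NormedAddCommGroup E] [NormedSpace ℝ E] [NormedAddCommGroup F]
  [NormedSpace ℝ F]

theorem fderiv_apply_of_related {φ : E → F} {X : F → F} {X' : E → E} {y : E}
    (hφ : ContDiffAt ℝ 2 φ y) (hX : DifferentiableAt ℝ X (φ y)) (hX' : DifferentiableAt ℝ X' y)
    (hrel : ∀ᶠ z in 𝓝 y, fderiv ℝ φ z (X' z) = X (φ z)) (w : E) :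
    fderiv ℝ X (φ y) (fderiv ℝ φ y w) =
      fderiv ℝ (fderiv ℝ φ) y (X' y) w + fderiv ℝ φ y (fderiv ℝ X' y w) := by
  have hφ' : HasFDerivAt φ (fderiv ℝ φ y) y := (hφ.differentiableAt (by simp)).hasFDerivAt
  have hφ'' : HasFDerivAt (fderiv ℝ φ) (fderiv ℝ (fderiv ℝ φ) y) y :=
    ((hφ.fderiv_right (m := 1) (by norm_num)).differentiableAt (by simp)).hasFDerivAt
  have hderiv : (fderiv ℝ φ y).comp (fderiv ℝ X' y) + (fderiv ℝ (fderiv ℝ φ) y).flip (X' y) =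
      (fderiv ℝ X (φ y)).comp (fderiv ℝ φ y) :=
    (hφ''.clm_apply hX'.hasFDerivAt).unique
      ((hX.hasFDerivAt.comp y hφ').congr_of_eventuallyEq hrel)
  rw [hφ.isSymmSndFDerivAt (by simp) (X' y) w, add_comm]
  exact (DFunLike.congr_fun hderiv w).symm

theorem fderiv_pullback_apply {k : ℕ} {φ : E → F} {η : F → F [⋀^Fin k]→L[ℝ] ℝ} {y : E}
    (hφ : ContDiffAt ℝ 2 φ y) (hη : DifferentiableAt ℝ η (φ y)) (w : E) (v : Fin k → E) :
    fderiv ℝ (fun z => (η (φ z)).compContinuousLinearMap (fderiv ℝ φ z)) y w v =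
      fderiv ℝ η (φ y) (fderiv ℝ φ y w) (fderiv ℝ φ y ∘ v) +
        ∑ i, η (φ y) (Function.update (fderiv ℝ φ y ∘ v) i (fderiv ℝ (fderiv ℝ φ) y w (v i))) := by
  have hφ' : HasFDerivAt φ (fderiv ℝ φ y) y := (hφ.differentiableAt (by simp)).hasFDerivAt
  have hφ'' : HasFDerivAt (fderiv ℝ φ) (fderiv ℝ (fderiv ℝ φ) y) y :=
    ((hφ.fderiv_right (m := 1) (by norm_num)).differentiableAt (by simp)).hasFDerivAt
  have hupdate (i : Fin k) : (fun j => Function.update (fun _ => fderiv ℝ φ y) i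
      (fderiv ℝ (fderiv ℝ φ) y w) j (v j)) =
      Function.update (fderiv ℝ φ y ∘ v) i (fderiv ℝ (fderiv ℝ φ) y w (v i)) := by
    ext1 j
    obtain rfl | h := eq_or_ne j i
    · simp
    · simp [Function.update_of_ne h]
  have hderiv : fderiv ℝ (fun z => (η (φ z)).compContinuousLinearMap (fderiv ℝ φ z)) y = _ :=
    (HasFDerivAt.continuousAlternatingMapCompContinuousLinearMap
      (hη.hasFDerivAt.comp y hφ') hφ'').fderiv
  rw [hderiv]
  simp only [add_apply, ContinuousLinearMap.comp_apply, ContinuousAlternatingMap.add_apply,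
    ContinuousAlternatingMap.compContinuousLinearMapCLM_apply,
    ContinuousAlternatingMap.compContinuousLinearMap_apply,
    ContinuousAlternatingMap.fderivCompContinuousLinearMap_apply, hupdate]
  rfl

theorem flatLieDeriv_pullback {k : ℕ} {φ : E → F} {X : F → F} {X' : E → E}
    {η : F → F [⋀^Fin k]→L[ℝ] ℝ} {η' : E → E [⋀^Fin k]→L[ℝ] ℝ} {y : E}
    (hφ : ContDiffAt ℝ 2 φ y) (hX : DifferentiableAt ℝ X (φ y)) (hX' : DifferentiableAt ℝ X' y)
    (hη : DifferentiableAt ℝ η (φ y)) (hrel : ∀ᶠ z in 𝓝 y, fderiv ℝ φ z (X' z) = X (φ z))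
    (hpull : ∀ᶠ z in 𝓝 y, η' z = (η (φ z)).compContinuousLinearMap (fderiv ℝ φ z)) :
    flatLieDeriv X' η' y = (flatLieDeriv X η (φ y)).compContinuousLinearMap (fderiv ℝ φ y) := by
  ext v
  rw [ContinuousAlternatingMap.compContinuousLinearMap_apply, flatLieDeriv_apply,
    flatLieDeriv_apply, EventuallyEq.fderiv_eq hpull, fderiv_pullback_apply hφ hη,
    hrel.self_of_nhds, add_assoc, ← Finset.sum_add_distrib]
  congr 1
  refine Finset.sum_congr rfl fun i _ => ?_
  rw [Function.comp_apply, fderiv_apply_of_related hφ hX hX' hrel,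
    ContinuousAlternatingMap.map_update_add, hpull.self_of_nhds,
    ContinuousAlternatingMap.compContinuousLinearMap_apply, Function.comp_update]

end FlatLieDerivative

section FlatDivergence

open Topology

variable {E : Type*} [NormedAddCommGroup E] [NormedSpace ℝ E]

/-- The divergence of a vector field on a finite-dimensional space with respect to the volume
`exp σ • volume`. Recording the logarithm `σ` of the density makes the divergence polynomial in the
derivatives of `σ` and `X`. -/
noncomputable def flatDivergence (σ : E → ℝ) (X : E → E) (y : E) : ℝ :=
  fderiv ℝ σ y (X y) + LinearMap.trace ℝ E (fderiv ℝ X y)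

/-- `Real.log` is the logarithm of the absolute value, so negative densities are allowed. -/
theorem flatLieDeriv_eq_flatDivergence_smul {k : ℕ} (b : Module.Basis (Fin k) ℝ E)
    (X : E → E) {η : E → E [⋀^Fin k]→L[ℝ] ℝ} {y : E} (hη : DifferentiableAt ℝ η y)
    (h0 : η y b ≠ 0) :
    flatLieDeriv X η y = flatDivergence (fun z => Real.log (η z b)) X y • η y := by
  have hlog : fderiv ℝ (fun z => Real.log (η z b)) y (X y) * η y b = fderiv ℝ η y (X y) b := by
    rw [((hη.hasFDerivAt.continuousAlternatingMap_apply_const b).log h0).fderiv, smul_apply,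
      smul_eq_mul, mul_right_comm, inv_mul_cancel₀ h0, one_mul]
    rfl
  have hb : flatLieDeriv X η y b = flatDivergence (fun z => Real.log (η z b)) X y * η y b := by
    rw [flatLieDeriv_apply, flatDivergence, add_mul, hlog]
    exact congrArg _ (sum_map_update_basis_eq_trace_mul b (η y).toAlternatingMap _)
  apply ContinuousAlternatingMap.toAlternatingMap_injective
  rw [AlternatingMap.eq_smul_basis_det b (flatLieDeriv X η y).toAlternatingMap,
    AlternatingMap.eq_smul_basis_det b (ContinuousAlternatingMap.toAlternatingMap (_ • η y))]
  exact congrArg (· • b.det) hb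

theorem flatDivergence_congr (σ : E → ℝ) {X Y : E → E} {y : E} (h : X =ᶠ[𝓝 y] Y) :
    flatDivergence σ X y = flatDivergence σ Y y := by
  rw [flatDivergence, flatDivergence, h.eq_of_nhds, h.fderiv_eq]

variable [FiniteDimensional ℝ E]

/-- The trace of an endomorphism, as a continuous linear form. -/
noncomputable def traceCLM (E : Type*) [NormedAddCommGroup E] [NormedSpace ℝ E]
    [FiniteDimensional ℝ E] : (E →L[ℝ] E) →L[ℝ] ℝ :=
  LinearMap.toContinuousLinearMap (LinearMap.trace ℝ E ∘ₗ ContinuousLinearMap.coeLM ℝ)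

theorem traceCLM_apply (A : E →L[ℝ] E) : traceCLM E A = LinearMap.trace ℝ E A := rfl

theorem traceCLM_smulRight (l : E →L[ℝ] ℝ) (v : E) : traceCLM E (l.smulRight v) = l v :=
  LinearMap.trace_smulRight (l : E →ₗ[ℝ] ℝ) v

theorem traceCLM_comp_comm (A B : E →L[ℝ] E) : traceCLM E (A.comp B) = traceCLM E (B.comp A) :=
  LinearMap.trace_mul_comm ℝ (A : E →ₗ[ℝ] E) (B : E →ₗ[ℝ] E)

theorem hasFDerivAt_traceCLM_fderiv {X : E → E} {y : E} (hX : ContDiffAt ℝ 2 X y) :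
    HasFDerivAt (fun z => traceCLM E (fderiv ℝ X z))
      ((traceCLM E).comp (fderiv ℝ (fderiv ℝ X) y)) y :=
  (traceCLM E).hasFDerivAt.comp y
    ((hX.fderiv_right (m := 1) (by norm_num)).differentiableAt (by simp)).hasFDerivAt

theorem contDiffAt_flatDivergence {σ : E → ℝ} {X : E → E} {y : E} {m : WithTop ℕ∞}
    (hσ : ContDiffAt ℝ (m + 1) σ y) (hX : ContDiffAt ℝ (m + 1) X y) :
    ContDiffAt ℝ m (flatDivergence σ X) y :=
  ((hσ.fderiv_right le_rfl).clm_apply (hX.of_le le_self_add)).add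
    ((traceCLM E).contDiff.contDiffAt.comp y (hX.fderiv_right le_rfl))

theorem flatDivergence_smul {σ f : E → ℝ} {X : E → E} {y : E} (hf : DifferentiableAt ℝ f y)
    (hX : DifferentiableAt ℝ X y) :
    flatDivergence σ (fun z => f z • X z) y = f y * flatDivergence σ X y + fderiv ℝ f y (X y) := by
  simp only [flatDivergence, ← traceCLM_apply]
  rw [fderiv_fun_smul hf hX, map_add, map_smul, map_smul, traceCLM_smulRight, smul_eq_mul,
    smul_eq_mul]
  ring

theorem traceCLM_fderiv_lieBracket {X Y : E → E} {y : E} (hX : ContDiffAt ℝ 2 X y)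
    (hY : ContDiffAt ℝ 2 Y y) :
    traceCLM E (fderiv ℝ (VectorField.lieBracket ℝ X Y) y) =
      fderiv ℝ (fun z => traceCLM E (fderiv ℝ Y z)) y (X y) -
        fderiv ℝ (fun z => traceCLM E (fderiv ℝ X z)) y (Y y) := by
  have hd {Z : E → E} (hZ : ContDiffAt ℝ 2 Z y) : HasFDerivAt Z (fderiv ℝ Z y) y :=
    (hZ.differentiableAt (by simp)).hasFDerivAt
  have hd' {Z : E → E} (hZ : ContDiffAt ℝ 2 Z y) :
      HasFDerivAt (fderiv ℝ Z) (fderiv ℝ (fderiv ℝ Z) y) y :=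
    ((hZ.fderiv_right (m := 1) (by norm_num)).differentiableAt (by simp)).hasFDerivAt
  have hsymm {Z : E → E} (hZ : ContDiffAt ℝ 2 Z y) (v : E) :
      (fderiv ℝ (fderiv ℝ Z) y).flip v = fderiv ℝ (fderiv ℝ Z) y v :=
    ContinuousLinearMap.ext fun w => hZ.isSymmSndFDerivAt (by simp) w v
  have hbracket : fderiv ℝ (VectorField.lieBracket ℝ X Y) y = _ :=
    (((hd' hY).clm_apply (hd hX)).sub ((hd' hX).clm_apply (hd hY))).fderiv
  rw [hbracket, hsymm hX, hsymm hY, map_sub, map_add, map_add, traceCLM_comp_comm,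
    (hasFDerivAt_traceCLM_fderiv hX).fderiv, (hasFDerivAt_traceCLM_fderiv hY).fderiv]
  exact add_sub_add_left_eq_sub _ _ _

theorem flatDivergence_lieBracket {σ : E → ℝ} {X Y : E → E} {y : E}
    (hσ : ContDiffAt ℝ 2 σ y) (hX : ContDiffAt ℝ 2 X y) (hY : ContDiffAt ℝ 2 Y y) :
    flatDivergence σ (VectorField.lieBracket ℝ X Y) y =
      fderiv ℝ (flatDivergence σ Y) y (X y) - fderiv ℝ (flatDivergence σ X) y (Y y) := by
  have hderiv {Z : E → E} (hZ : ContDiffAt ℝ 2 Z y) (w : E) :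
      fderiv ℝ (flatDivergence σ Z) y w = fderiv ℝ (fun z => fderiv ℝ σ z (Z z)) y w +
        fderiv ℝ (fun z => traceCLM E (fderiv ℝ Z z)) y w :=
    DFunLike.congr_fun (fderiv_fun_add
      (((hσ.fderiv_right (m := 1) (by norm_num)).differentiableAt (by simp)).clm_apply
        (hZ.differentiableAt (by simp)))
      (hasFDerivAt_traceCLM_fderiv hZ).differentiableAt) w
  rw [flatDivergence, ← traceCLM_apply, traceCLM_fderiv_lieBracket hX hY,
    VectorField.fderiv_apply_lieBracket hσ (by simp) (hY.differentiableAt (by simp))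
      (hX.differentiableAt (by simp)), hderiv hX, hderiv hY]
  ring

end FlatDivergence

section DivergenceFree

open Topology

variable {E : Type*} [NormedAddCommGroup E] [NormedSpace ℝ E]

/-- The Hamiltonian vector field of `g` in the directions `u` and `v`, whose trace vanishes by the
symmetry of second derivatives. -/
noncomputable def planarHamiltonian (g : E → ℝ) (u v : E) (y : E) : E :=
  fderiv ℝ g y u • v - fderiv ℝ g y v • u

theorem contDiff_planarHamiltonian {g : E → ℝ} {m : WithTop ℕ∞} (hg : ContDiff ℝ (m + 1) g)
    (u v : E) : ContDiff ℝ m (planarHamiltonian g u v) :=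
  have hg' : ContDiff ℝ m (fderiv ℝ g) := hg.fderiv_right le_rfl
  ((hg'.clm_apply contDiff_const).smul contDiff_const).sub
    ((hg'.clm_apply contDiff_const).smul contDiff_const)

theorem tsupport_planarHamiltonian_subset (g : E → ℝ) (u v : E) :
    tsupport (planarHamiltonian g u v) ⊆ tsupport g := by
  refine closure_minimal (fun y hy => ?_) (isClosed_tsupport g)
  by_contra hyg
  have hzero : fderiv ℝ g y = 0 :=
    image_eq_zero_of_notMem_tsupport fun h => hyg (tsupport_fderiv_subset ℝ h)
  exact hy (by simp [planarHamiltonian, hzero])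

theorem traceCLM_fderiv_planarHamiltonian [FiniteDimensional ℝ E] {g : E → ℝ} {y : E}
    (hg : ContDiffAt ℝ 2 g y) (u v : E) :
    traceCLM E (fderiv ℝ (planarHamiltonian g u v) y) = 0 := by
  have hd : HasFDerivAt (fderiv ℝ g) (fderiv ℝ (fderiv ℝ g) y) y :=
    ((hg.fderiv_right (m := 1) (by norm_num)).differentiableAt (by simp)).hasFDerivAt
  have hdir (w : E) :
      HasFDerivAt (fun z => fderiv ℝ g z w) ((fderiv ℝ (fderiv ℝ g) y).flip w) y := by
    simpa using hd.clm_apply (hasFDerivAt_const w y)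
  have hderiv : fderiv ℝ (planarHamiltonian g u v) y = _ :=
    (((hdir u).smul_const v).sub ((hdir v).smul_const u)).fderiv
  rw [hderiv, map_sub, traceCLM_smulRight, traceCLM_smulRight, sub_eq_zero]
  exact hg.isSymmSndFDerivAt (by simp) v u

theorem flatDivergence_exp_neg_smul [FiniteDimensional ℝ E] {σ : E → ℝ} {W : E → E} {y : E}
    (hσ : DifferentiableAt ℝ σ y) (hW : DifferentiableAt ℝ W y) :
    flatDivergence σ (fun z => Real.exp (-σ z) • W z) y =
      Real.exp (-σ y) * traceCLM E (fderiv ℝ W y) := by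
  rw [flatDivergence_smul hσ.fun_neg.exp hW, hσ.hasFDerivAt.fun_neg.exp.fderiv, flatDivergence,
    ← traceCLM_apply]
  simp only [smul_apply, neg_apply, smul_eq_mul]
  ring

theorem exists_contDiff_tsupport_subset_fderiv_eq [FiniteDimensional ℝ E] {U : Set E} {p : E}
    (hU : U ∈ 𝓝 p) (l : E →L[ℝ] ℝ) :
    ∃ g : E → ℝ, tsupport g ⊆ U ∧ HasCompactSupport g ∧ ContDiff ℝ ∞ g ∧ fderiv ℝ g p = l := by
  obtain ⟨χ, hχU, hχc, hχ, -, hχp⟩ := exists_contDiff_tsupport_subset (n := ⊤) hU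
  have hlin : HasFDerivAt (fun y => l (y - p)) l p :=
    l.hasFDerivAt.comp p ((hasFDerivAt_id p).sub_const p)
  refine ⟨fun y => χ y * l (y - p), (tsupport_mul_subset_left).trans hχU, hχc.mul_right,
    hχ.mul (l.contDiff.comp (contDiff_id.sub contDiff_const)), ?_⟩
  rw [fderiv_fun_mul (hχ.differentiable (by simp) p) hlin.differentiableAt, hlin.fderiv, hχp]
  simp

theorem exists_apply_eq_apply_eq_zero [FiniteDimensional ℝ E] (hE : 1 < Module.finrank ℝ E) (v : E)
    (c : ℝ) : ∃ (l : E →L[ℝ] ℝ) (u : E), l u = c ∧ l v = 0 := by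
  have hspan : Submodule.span ℝ {v} < ⊤ := span_lt_top_of_card_lt_finrank (by simpa using hE)
  obtain ⟨l, hl, hv⟩ := Submodule.exists_le_ker_of_lt_top _ hspan
  obtain ⟨u, hu⟩ := LinearMap.surjective hl c
  exact ⟨LinearMap.toContinuousLinearMap l, u, hu, hv (Submodule.mem_span_singleton_self v)⟩

/-- The field is `exp (-σ)` times a Hamiltonian field: the factor turns fields of zero trace into
fields without divergence. -/
theorem exists_flatDivergence_eq_zero_apply_eq [FiniteDimensional ℝ E]
    (hE : 1 < Module.finrank ℝ E) {σ : E → ℝ} {U : Set E} (hU : IsOpen U) (hσ : ContDiffOn ℝ ∞ σ U)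
    {p : E} (hp : p ∈ U) (v : E) :
    ∃ Z : E → E, ContDiff ℝ ∞ Z ∧ HasCompactSupport Z ∧ tsupport Z ⊆ U ∧
      (∀ y, flatDivergence σ Z y = 0) ∧ Z p = v := by
  obtain ⟨l, u, hlu, hlv⟩ := exists_apply_eq_apply_eq_zero hE v (Real.exp (σ p))
  obtain ⟨g, hgU, hgc, hg, hgp⟩ := exists_contDiff_tsupport_subset_fderiv_eq (hU.mem_nhds hp) l
  let W := planarHamiltonian g u v
  have hW : ContDiff ℝ ∞ W := contDiff_planarHamiltonian hg u v
  let Z : E → E := fun y => Real.exp (-σ y) • W y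
  have hZg : tsupport Z ⊆ tsupport g :=
    (tsupport_smul_subset_right _ _).trans (tsupport_planarHamiltonian_subset g u v)
  have hσ' {y : E} (hy : y ∈ U) : ContDiffAt ℝ ∞ σ y := hσ.contDiffAt (hU.mem_nhds hy)
  refine ⟨Z, contMDiff_iff_contDiff.1 <| contMDiff_of_tsupport fun y hy => ?_,
    hgc.mono' (subset_closure.trans hZg), hZg.trans hgU, fun y => ?_, ?_⟩
  · exact ((hσ' (hgU (hZg hy))).neg.exp.smul hW.contDiffAt).contMDiffAt
  · by_cases hy : y ∈ U
    · rw [flatDivergence_exp_neg_smul ((hσ' hy).differentiableAt (by simp))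
        (hW.differentiable (by simp) y), traceCLM_fderiv_planarHamiltonian
        (hg.contDiffAt.of_le (SmoothVectorField.natCast_le_infty 2)), mul_zero]
    · rw [flatDivergence_congr σ (notMem_tsupport_iff_eventuallyEq.1 fun h => hy (hgU (hZg h)))]
      simp [flatDivergence]
  · simp only [Z, W, planarHamiltonian, hgp, hlu, hlv, zero_smul, sub_zero, smul_smul,
      ← Real.exp_add, neg_add_cancel, Real.exp_zero, one_smul]

end DivergenceFree

section ChartDerivatives

variable {𝕜 E H M : Type*} [NontriviallyNormedField 𝕜] [NormedAddCommGroup E] [NormedSpace 𝕜 E]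
  [TopologicalSpace H] {I : ModelWithCorners 𝕜 E H} [TopologicalSpace M] [ChartedSpace H M]

theorem exists_extChartAt_symm_eq {x₀ x : M} (hx : x ∈ (extChartAt I x₀).source) :
    ∃ y ∈ (extChartAt I x₀).target, (extChartAt I x₀).symm y = x :=
  ⟨_, (extChartAt I x₀).map_source hx, (extChartAt I x₀).left_inv hx⟩

variable [I.Boundaryless]

theorem contMDiffAt_extChartAt_symm {m : WithTop ℕ∞} [IsManifold I m M] {x₀ : M} {y : E}
    (hy : y ∈ (extChartAt I x₀).target) :
    ContMDiffAt 𝓘(𝕜, E) I m (extChartAt I x₀).symm y :=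
  (contMDiffOn_extChartAt_symm x₀).contMDiffAt ((isOpen_extChartAt_target x₀).mem_nhds hy)

variable [IsManifold I 1 M]

theorem mfderiv_extChartAt_comp_mfderiv_extChartAt_symm {x₀ : M} {y : E}
    (hy : y ∈ (extChartAt I x₀).target) :
    (mfderiv% (extChartAt I x₀) ((extChartAt I x₀).symm y)).comp
      (mfderiv% (extChartAt I x₀).symm y) = ContinuousLinearMap.id 𝕜 _ := by
  have h := mfderiv_extChartAt_comp_mfderivWithin_extChartAt_symm hy
  rwa [I.range_eq_univ, mfderivWithin_univ] at h

theorem mfderiv_extChartAt_symm_comp_mfderiv_extChartAt {x₀ : M} {y : E}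
    (hy : y ∈ (extChartAt I x₀).target) :
    (mfderiv% (extChartAt I x₀).symm y).comp
      (mfderiv% (extChartAt I x₀) ((extChartAt I x₀).symm y)) = ContinuousLinearMap.id 𝕜 _ := by
  have h := mfderivWithin_extChartAt_symm_comp_mfderiv_extChartAt hy
  rwa [I.range_eq_univ, mfderivWithin_univ] at h

theorem isInvertible_mfderiv_extChartAt_symm {x₀ : M} {y : E}
    (hy : y ∈ (extChartAt I x₀).target) :
    (mfderiv% (extChartAt I x₀).symm y).IsInvertible := by
  have h := isInvertible_mfderivWithin_extChartAt_symm hy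
  rwa [I.range_eq_univ, mfderivWithin_univ] at h

theorem fderiv_extChartAt_comp_symm {x₀ x : M} {z : E} (hz : z ∈ (extChartAt I x).target)
    (hz₀ : (extChartAt I x).symm z ∈ (extChartAt I x₀).source) :
    fderiv 𝕜 (extChartAt I x₀ ∘ (extChartAt I x).symm) z =
      (mfderiv% (extChartAt I x₀) ((extChartAt I x).symm z)).comp
        (mfderiv% (extChartAt I x).symm z) := by
  rw [← mfderiv_eq_fderiv]
  exact mfderiv_comp z (mdifferentiableAt_extChartAt (by rwa [extChartAt_source] at hz₀))
    ((contMDiffAt_extChartAt_symm hz).mdifferentiableAt one_ne_zero)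

theorem fderiv_extChartAt_comp_symm_comp_mfderiv {x₀ x x' : M}
    (hx' : x' ∈ (extChartAt I x).source) (hx'₀ : x' ∈ (extChartAt I x₀).source) :
    (fderiv 𝕜 (extChartAt I x₀ ∘ (extChartAt I x).symm) (extChartAt I x x')).comp
      (mfderiv% (extChartAt I x) x') = mfderiv% (extChartAt I x₀) x' := by
  obtain ⟨z, hz, rfl⟩ := exists_extChartAt_symm_eq hx'
  rw [(extChartAt I x).right_inv hz, fderiv_extChartAt_comp_symm hz hx'₀]
  ext v
  exact congrArg _ (DFunLike.congr_fun (mfderiv_extChartAt_symm_comp_mfderiv_extChartAt hz) v)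

end ChartDerivatives

section LocallyConstant

open Topology

variable {E H M F : Type*} [NormedAddCommGroup E] [NormedSpace ℝ E] [TopologicalSpace H]
  {I : ModelWithCorners ℝ E H} [I.Boundaryless] [TopologicalSpace M] [ChartedSpace H M]
  [NormedAddCommGroup F] [NormedSpace ℝ F]

theorem isLocallyConstant_of_mvfderiv_eq_zero [IsManifold I 1 M] {f : M → F}
    (hf : MDifferentiable I 𝓘(ℝ, F) f) (h : ∀ x, mvfderiv I f x = 0) : IsLocallyConstant f := by
  refine (IsLocallyConstant.iff_eventually_eq _).2 fun x => ?_
  have hg {y : E} (hy : y ∈ (extChartAt I x).target) :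
      HasFDerivAt (f ∘ (extChartAt I x).symm) (0 : E →L[ℝ] F) y := by
    have hcomp := (hf _).hasMFDerivAt.comp y
      ((contMDiffAt_extChartAt_symm (m := 1) hy).mdifferentiableAt one_ne_zero).hasMFDerivAt
    refine hcomp.hasFDerivAt.congr_fderiv (ContinuousLinearMap.ext fun v => ?_)
    exact DFunLike.congr_fun (h _) (mfderiv% (extChartAt I x).symm y v)
  obtain ⟨r, hr, hball⟩ := Metric.mem_nhds_iff.1 (extChartAt_target_mem_nhds (I := I) x)
  filter_upwards [(continuousAt_extChartAt (I := I) x).preimage_mem_nhds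
    (Metric.ball_mem_nhds _ hr), extChartAt_source_mem_nhds (I := I) x] with x' hx' hxs
  have hconst := Metric.isOpen_ball.is_const_of_fderiv_eq_zero (convex_ball _ _).isPreconnected
    (fun y hy => (hg (hball hy)).differentiableAt.differentiableWithinAt)
    (fun y hy => (hg (hball hy)).fderiv) hx' (Metric.mem_ball_self hr)
  simpa only [Function.comp_apply, (extChartAt I x).left_inv hxs, extChartAt_to_inv] using hconst

end LocallyConstant

open Topology in
theorem infinite_of_isOpen_of_nonempty_of_chartedSpace (H : Type*) {M : Type*}
    [TopologicalSpace H] [T1Space H] [PerfectSpace H] [TopologicalSpace M] [ChartedSpace H M]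
    {U : Set M} (hU : IsOpen U) (hne : U.Nonempty) : U.Infinite := by
  obtain ⟨x, hx⟩ := hne
  let φ := chartAt H x
  have hmem : φ.target ∩ φ.symm ⁻¹' U ∈ 𝓝 (φ x) :=
    (φ.isOpen_inter_preimage_symm hU).mem_nhds
      ⟨mem_chart_target H x, by rwa [Set.mem_preimage, φ.left_inv (mem_chart_source H x)]⟩
  exact ((infinite_of_mem_nhds _ hmem).image (φ.symm.injOn.mono Set.inter_subset_left)).mono
    (Set.image_subset_iff.2 Set.inter_subset_right)

section Charts

open Filter Topology

variable {n : ℕ} {M : Type*} [TopologicalSpace M] [ChartedSpace (EuclideanSpace ℝ (Fin n)) M]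
  [IsManifold (𝓡 n) ∞ M]

theorem mfderiv_extChartAt_symm_fieldInChart (X : ∀ x : M, TangentSpace (𝓡 n) x) {x₀ : M}
    {y : EuclideanSpace ℝ (Fin n)} (hy : y ∈ (extChartAt (𝓡 n) x₀).target) :
    mfderiv (𝓡 n) (𝓡 n) (extChartAt (𝓡 n) x₀).symm y (fieldInChart X x₀ y) =
      X ((extChartAt (𝓡 n) x₀).symm y) :=
  (isInvertible_mfderiv_extChartAt_symm hy).self_apply_inverse _

theorem fieldInChart_extChartAt (X : ∀ x : M, TangentSpace (𝓡 n) x) {x₀ x : M}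
    (hx : x ∈ (extChartAt (𝓡 n) x₀).source) :
    fieldInChart X x₀ (extChartAt (𝓡 n) x₀ x) =
      mfderiv (𝓡 n) (𝓡 n) (extChartAt (𝓡 n) x₀) x (X x) := by
  obtain ⟨y, hy, rfl⟩ := exists_extChartAt_symm_eq hx
  rw [(extChartAt (𝓡 n) x₀).right_inv hy, ← mfderiv_extChartAt_symm_fieldInChart X hy]
  exact (DFunLike.congr_fun (mfderiv_extChartAt_comp_mfderiv_extChartAt_symm hy) _).symm

theorem formInChart_extChartAt_comp_mfderiv {k : ℕ}
    (η : ∀ x : M, TangentSpace (𝓡 n) x [⋀^Fin k]→L[ℝ] ℝ) {x₀ x : M}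
    (hx : x ∈ (extChartAt (𝓡 n) x₀).source) :
    (formInChart η x₀ (extChartAt (𝓡 n) x₀ x)).compContinuousLinearMap
      (mfderiv (𝓡 n) (𝓡 n) (extChartAt (𝓡 n) x₀) x) = η x := by
  obtain ⟨y, hy, rfl⟩ := exists_extChartAt_symm_eq hx
  rw [(extChartAt (𝓡 n) x₀).right_inv hy]
  ext v
  exact congrArg (η _) (funext fun i =>
    DFunLike.congr_fun (mfderiv_extChartAt_symm_comp_mfderiv_extChartAt hy) (v i))

theorem SmoothVectorField.contDiffAt_fieldInChart (X : SmoothVectorField n M) {x₀ : M}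
    {y : EuclideanSpace ℝ (Fin n)} (hy : y ∈ (extChartAt (𝓡 n) x₀).target) :
    ContDiffAt ℝ ∞ (fieldInChart X x₀) y :=
  contMDiffAt_vectorSpace_iff_contDiffAt.1 (ContMDiffAt.mpullback_vectorField_preimage
    X.contMDiff.contMDiffAt (contMDiffAt_extChartAt_symm (m := ∞) hy)
    (isInvertible_mfderiv_extChartAt_symm hy) le_rfl)

theorem SmoothVectorField.fieldInChart_bracket (X Y : SmoothVectorField n M) {x₀ : M}
    {y : EuclideanSpace ℝ (Fin n)} (hy : y ∈ (extChartAt (𝓡 n) x₀).target) :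
    fieldInChart ⇑⁅X, Y⁆ x₀ y =
      VectorField.lieBracket ℝ (fieldInChart X x₀) (fieldInChart Y x₀) y := by
  have := isManifold_of_infty n M 2
  have : IsManifold (𝓡 n) (minSmoothness ℝ 3) M := by simpa using isManifold_of_infty n M 3
  refine (VectorField.mpullback_mlieBracket (X.mdiffAt _) (Y.mdiffAt _)
    (contMDiffAt_extChartAt_symm (m := ∞) hy) (by simpa using natCast_le_infty 2)).trans ?_
  rw [← VectorField.mlieBracketWithin_univ, VectorField.mlieBracketWithin_eq_lieBracketWithin]
  exact congrFun VectorField.lieBracketWithin_univ y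

section ChangeOfChart

variable {x₀ x : M} {z : EuclideanSpace ℝ (Fin n)}

theorem fderiv_extChartAt_comp_symm_fieldInChart (X : ∀ x : M, TangentSpace (𝓡 n) x)
    (hz : z ∈ (extChartAt (𝓡 n) x).target)
    (hz₀ : (extChartAt (𝓡 n) x).symm z ∈ (extChartAt (𝓡 n) x₀).source) :
    fderiv ℝ (extChartAt (𝓡 n) x₀ ∘ (extChartAt (𝓡 n) x).symm) z (fieldInChart X x z) =
      fieldInChart X x₀ (extChartAt (𝓡 n) x₀ ((extChartAt (𝓡 n) x).symm z)) := by
  rw [fderiv_extChartAt_comp_symm hz hz₀]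
  exact (congrArg _ (mfderiv_extChartAt_symm_fieldInChart X hz)).trans
    (fieldInChart_extChartAt X hz₀).symm

theorem formInChart_eq_compContinuousLinearMap_fderiv {k : ℕ}
    (η : ∀ x : M, TangentSpace (𝓡 n) x [⋀^Fin k]→L[ℝ] ℝ)
    (hz : z ∈ (extChartAt (𝓡 n) x).target)
    (hz₀ : (extChartAt (𝓡 n) x).symm z ∈ (extChartAt (𝓡 n) x₀).source) :
    formInChart η x z =
      (formInChart η x₀ (extChartAt (𝓡 n) x₀ ((extChartAt (𝓡 n) x).symm z))).compContinuousLinearMap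
        (fderiv ℝ (extChartAt (𝓡 n) x₀ ∘ (extChartAt (𝓡 n) x).symm) z) := by
  rw [fderiv_extChartAt_comp_symm hz hz₀]
  exact congrArg (fun θ : TangentSpace (𝓡 n) ((extChartAt (𝓡 n) x).symm z) [⋀^Fin k]→L[ℝ] ℝ =>
    θ.compContinuousLinearMap (mfderiv (𝓡 n) (𝓡 n) (extChartAt (𝓡 n) x).symm z))
    (formInChart_extChartAt_comp_mfderiv η hz₀).symm

end ChangeOfChart

theorem lieDeriv_eq_of_mem_source {k : ℕ} (X : SmoothVectorField n M)
    {η : ∀ x : M, TangentSpace (𝓡 n) x [⋀^Fin k]→L[ℝ] ℝ} {x₀ x : M}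
    (hη : DifferentiableAt ℝ (formInChart η x₀) (extChartAt (𝓡 n) x₀ x))
    (hx : x ∈ (extChartAt (𝓡 n) x₀).source) :
    lieDeriv X η x =
      (flatLieDeriv (fieldInChart X x₀) (formInChart η x₀)
        (extChartAt (𝓡 n) x₀ x)).compContinuousLinearMap
          (mfderiv (𝓡 n) (𝓡 n) (extChartAt (𝓡 n) x₀) x) := by
  let φ₀ := extChartAt (𝓡 n) x₀
  let φ := extChartAt (𝓡 n) x
  have hinv : φ.symm (φ x) = x := extChartAt_to_inv x
  have hmem : ∀ᶠ z in 𝓝 (φ x), z ∈ φ.target ∧ φ.symm z ∈ φ₀.source :=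
    (eventually_mem_set.2 (extChartAt_target_mem_nhds x)).and <|
      (continuousAt_extChartAt_symm x).eventually_mem <|
        extChartAt_source_mem_nhds' (by rwa [hinv])
  have hτ : ContDiffAt ℝ ∞ (φ₀ ∘ φ.symm) (φ x) :=
    (contDiffOn_ext_coord_change x₀ x).contDiffAt hmem
  have hX : DifferentiableAt ℝ (fieldInChart X x₀) (φ₀ (φ.symm (φ x))) := by
    rw [hinv]
    exact (X.contDiffAt_fieldInChart (φ₀.map_source hx)).differentiableAt (by simp)
  have hnat := flatLieDeriv_pullback (hτ.of_le (SmoothVectorField.natCast_le_infty 2)) hX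
    (X.differentiableAt_fieldInChart x) (by rwa [Function.comp_apply, hinv])
    (hmem.mono fun z hz => fderiv_extChartAt_comp_symm_fieldInChart X hz.1 hz.2)
    (hmem.mono fun z hz => formInChart_eq_compContinuousLinearMap_fderiv η hz.1 hz.2)
  rw [lieDeriv, hnat, Function.comp_apply, hinv,
    ← fderiv_extChartAt_comp_symm_comp_mfderiv (mem_extChartAt_source x) hx]
  rfl

end Charts

section Divergence

open Filter Topology

variable {n : ℕ} {M : Type*} [TopologicalSpace M] [ChartedSpace (EuclideanSpace ℝ (Fin n)) M]

namespace VolumeForm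

/-- The logarithm of the absolute density of `μ` with respect to Lebesgue measure in the chart at
`x₀`: a sign change of the coordinate expression of `μ` is absorbed by `Real.log`. -/
noncomputable def logDensity (μ : VolumeForm n M) (x₀ : M) (y : EuclideanSpace ℝ (Fin n)) : ℝ :=
  Real.log (formInChart μ.form x₀ y (EuclideanSpace.basisFun (Fin n) ℝ).toBasis)

theorem contDiffAt_formInChart (μ : VolumeForm n M) {x₀ : M} {y : EuclideanSpace ℝ (Fin n)}
    (hy : y ∈ (extChartAt (𝓡 n) x₀).target) : ContDiffAt ℝ ∞ (formInChart μ.form x₀) y :=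
  (μ.smooth x₀).contDiffAt ((isOpen_extChartAt_target x₀).mem_nhds hy)

variable [IsManifold (𝓡 n) ∞ M]

theorem formInChart_apply_basis_ne_zero (μ : VolumeForm n M) {x₀ : M}
    {y : EuclideanSpace ℝ (Fin n)} (hy : y ∈ (extChartAt (𝓡 n) x₀).target)
    (b : Module.Basis (Fin n) ℝ (EuclideanSpace ℝ (Fin n))) : formInChart μ.form x₀ y b ≠ 0 := by
  intro h
  have hzero : formInChart μ.form x₀ y = 0 := ContinuousAlternatingMap.toAlternatingMap_injective
    ((AlternatingMap.map_basis_eq_zero_iff b (formInChart μ.form x₀ y).toAlternatingMap).1 h)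
  have hform := formInChart_extChartAt_comp_mfderiv μ.form ((extChartAt (𝓡 n) x₀).map_target hy)
  rw [(extChartAt (𝓡 n) x₀).right_inv hy, hzero] at hform
  exact μ.ne_zero _ hform.symm

theorem contDiffAt_logDensity (μ : VolumeForm n M) {x₀ : M} {y : EuclideanSpace ℝ (Fin n)}
    (hy : y ∈ (extChartAt (𝓡 n) x₀).target) : ContDiffAt ℝ ∞ (μ.logDensity x₀) y :=
  ((ContinuousAlternatingMap.apply ℝ (EuclideanSpace ℝ (Fin n)) ℝ
    (EuclideanSpace.basisFun (Fin n) ℝ).toBasis).contDiff.contDiffAt.comp y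
      (μ.contDiffAt_formInChart hy)).log (μ.formInChart_apply_basis_ne_zero hy _)

theorem lieDeriv_eq_flatDivergence_smul (μ : VolumeForm n M) (X : SmoothVectorField n M)
    {x₀ x : M} (hx : x ∈ (extChartAt (𝓡 n) x₀).source) :
    lieDeriv X μ.form x = flatDivergence (μ.logDensity x₀) (fieldInChart X x₀)
      (extChartAt (𝓡 n) x₀ x) • μ.form x := by
  have hy := (extChartAt (𝓡 n) x₀).map_source hx
  have hμ := (μ.contDiffAt_formInChart hy).differentiableAt (by simp)
  rw [lieDeriv_eq_of_mem_source X hμ hx, flatLieDeriv_eq_flatDivergence_smul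
    (EuclideanSpace.basisFun (Fin n) ℝ).toBasis _ hμ (μ.formInChart_apply_basis_ne_zero hy _)]
  exact congrArg (flatDivergence (μ.logDensity x₀) _ (extChartAt (𝓡 n) x₀ x) • ·)
    (formInChart_extChartAt_comp_mfderiv μ.form hx)

/-- The divergence `div_μ X` of a vector field, defined by `L_X μ = (div_μ X) μ`, as a linear map;
it is evaluated at `x` in the preferred chart at `x`. -/
noncomputable def divergence (μ : VolumeForm n M) : SmoothVectorField n M →ₗ[ℝ] M → ℝ where
  toFun X x := flatDivergence (μ.logDensity x) (fieldInChart X x) (extChartAt (𝓡 n) x x)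
  map_add' X Y := funext fun x => smul_left_injective ℝ (μ.ne_zero x) <| by
    simp only [Pi.add_apply, add_smul,
      ← μ.lieDeriv_eq_flatDivergence_smul _ (mem_extChartAt_source x), lieDeriv_add]
  map_smul' c X := funext fun x => smul_left_injective ℝ (μ.ne_zero x) <| by
    simp only [Pi.smul_apply, RingHom.id_apply, smul_assoc,
      ← μ.lieDeriv_eq_flatDivergence_smul _ (mem_extChartAt_source x), lieDeriv_smul]

theorem lieDeriv_eq_divergence_smul (μ : VolumeForm n M) (X : SmoothVectorField n M) (x : M) :
    lieDeriv X μ.form x = μ.divergence X x • μ.form x :=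
  μ.lieDeriv_eq_flatDivergence_smul X (mem_extChartAt_source x)

theorem mem_conformalFields_iff (μ : VolumeForm n M) (X : SmoothVectorField n M) :
    X ∈ conformalFields μ ↔ ∃ c : ℝ, ∀ x, μ.divergence X x = c := by
  refine exists_congr fun c => forall_congr' fun x => ?_
  rw [lieDeriv_eq_divergence_smul, (smul_left_injective ℝ (μ.ne_zero x)).eq_iff]

theorem ker_divergence_le_conformalFields (μ : VolumeForm n M) :
    LinearMap.ker μ.divergence ≤ conformalFields μ := fun X hX =>
  (μ.mem_conformalFields_iff X).2 ⟨0, fun x => congrFun (LinearMap.mem_ker.1 hX) x⟩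

theorem divergence_eq_flatDivergence (μ : VolumeForm n M) (X : SmoothVectorField n M) {x₀ x : M}
    (hx : x ∈ (extChartAt (𝓡 n) x₀).source) :
    μ.divergence X x =
      flatDivergence (μ.logDensity x₀) (fieldInChart X x₀) (extChartAt (𝓡 n) x₀ x) :=
  smul_left_injective ℝ (μ.ne_zero x)
    ((μ.lieDeriv_eq_divergence_smul X x).symm.trans (μ.lieDeriv_eq_flatDivergence_smul X hx))

theorem divergence_eventuallyEq (μ : VolumeForm n M) (X : SmoothVectorField n M) (x : M) :
    μ.divergence X =ᶠ[𝓝 x]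
      flatDivergence (μ.logDensity x) (fieldInChart X x) ∘ extChartAt (𝓡 n) x :=
  mem_of_superset (extChartAt_source_mem_nhds x) fun _ => μ.divergence_eq_flatDivergence X

theorem contDiffAt_flatDivergence_fieldInChart (μ : VolumeForm n M) (X : SmoothVectorField n M)
    {x₀ : M} {y : EuclideanSpace ℝ (Fin n)} (hy : y ∈ (extChartAt (𝓡 n) x₀).target) :
    ContDiffAt ℝ ∞ (flatDivergence (μ.logDensity x₀) (fieldInChart X x₀)) y :=
  contDiffAt_flatDivergence (m := ∞) (μ.contDiffAt_logDensity hy) (X.contDiffAt_fieldInChart hy)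

theorem contMDiff_divergence (μ : VolumeForm n M) (X : SmoothVectorField n M) :
    ContMDiff (𝓡 n) 𝓘(ℝ, ℝ) ∞ (μ.divergence X) := fun x =>
  ((μ.contDiffAt_flatDivergence_fieldInChart X (mem_extChartAt_target x)).contMDiffAt.comp x
    contMDiffAt_extChartAt).congr_of_eventuallyEq (μ.divergence_eventuallyEq X x)

theorem mvfderiv_divergence_apply (μ : VolumeForm n M) (X Y : SmoothVectorField n M) (x : M) :
    mvfderiv (𝓡 n) (μ.divergence Y) x (X x) =
      fderiv ℝ (flatDivergence (μ.logDensity x) (fieldInChart Y x)) (extChartAt (𝓡 n) x x)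
        (fieldInChart X x (extChartAt (𝓡 n) x x)) := by
  have := SmoothVectorField.isManifold_of_infty n M 1
  have hd := ((μ.contDiffAt_flatDivergence_fieldInChart Y
    (mem_extChartAt_target x)).differentiableAt (by simp)).hasFDerivAt.hasMFDerivAt
  have hcomp := (hd.comp x (mdifferentiableAt_extChartAt
    (mem_chart_source _ x)).hasMFDerivAt).congr_of_eventuallyEq (μ.divergence_eventuallyEq Y x)
  exact (DFunLike.congr_fun hcomp.mfderiv (X x)).trans
    (congrArg _ (fieldInChart_extChartAt X (mem_extChartAt_source x)).symm)

theorem divergence_bracket (μ : VolumeForm n M) (X Y : SmoothVectorField n M) (x : M) :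
    μ.divergence ⁅X, Y⁆ x = mvfderiv (𝓡 n) (μ.divergence Y) x (X x) -
      mvfderiv (𝓡 n) (μ.divergence X) x (Y x) := by
  have hy := mem_extChartAt_target (I := 𝓡 n) x
  have hle := SmoothVectorField.natCast_le_infty 2
  have hbracket : fieldInChart ⇑⁅X, Y⁆ x =ᶠ[𝓝 (extChartAt (𝓡 n) x x)]
      VectorField.lieBracket ℝ (fieldInChart X x) (fieldInChart Y x) :=
    mem_of_superset (extChartAt_target_mem_nhds x) fun _ => X.fieldInChart_bracket Y
  rw [mvfderiv_divergence_apply, mvfderiv_divergence_apply,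
    μ.divergence_eq_flatDivergence _ (mem_extChartAt_source x), flatDivergence_congr _ hbracket]
  exact flatDivergence_lieBracket ((μ.contDiffAt_logDensity hy).of_le hle)
    ((X.contDiffAt_fieldInChart hy).of_le hle) ((Y.contDiffAt_fieldInChart hy).of_le hle)

theorem divergence_bracket_of_mem_ker (μ : VolumeForm n M) {X : SmoothVectorField n M}
    (hX : X ∈ LinearMap.ker μ.divergence) (Y : SmoothVectorField n M) (x : M) :
    μ.divergence ⁅X, Y⁆ x = mvfderiv (𝓡 n) (μ.divergence Y) x (X x) := by
  rw [divergence_bracket, LinearMap.mem_ker.1 hX, sub_eq_self]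
  exact DFunLike.congr_fun mvfderiv_zero (Y x)

theorem mem_conformalFields_of_mvfderiv_eq_zero [ConnectedSpace M] (μ : VolumeForm n M)
    {Y : SmoothVectorField n M} (h : ∀ x, mvfderiv (𝓡 n) (μ.divergence Y) x = 0) :
    Y ∈ conformalFields μ := by
  have := SmoothVectorField.isManifold_of_infty n M 1
  obtain ⟨x₀⟩ := (inferInstance : Nonempty M)
  have hloc := isLocallyConstant_of_mvfderiv_eq_zero
    ((μ.contMDiff_divergence Y).mdifferentiable (by simp)) h
  exact (μ.mem_conformalFields_iff Y).2
    ⟨μ.divergence Y x₀, fun x => hloc.apply_eq_of_preconnectedSpace x x₀⟩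

end VolumeForm

end Divergence

section ExtendByZero

open Topology

variable {𝕜 E H M : Type*} [NontriviallyNormedField 𝕜] [NormedAddCommGroup E] [NormedSpace 𝕜 E]
  [TopologicalSpace H] {I : ModelWithCorners 𝕜 E H} [TopologicalSpace M] [ChartedSpace H M]

open Classical in
/-- The extension by zero to `M` of the vector field whose expression in the chart at `x₀`
is `Z`. -/
noncomputable def extendByZero (I : ModelWithCorners 𝕜 E H) (x₀ : M) (Z : E → E) (x : M) :
    TangentSpace I x :=
  if x ∈ (extChartAt I x₀).source then
    VectorField.mpullback I 𝓘(𝕜, E) (extChartAt I x₀) Z x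
  else 0

theorem extendByZero_of_mem_source {x₀ x : M} (Z : E → E) (hx : x ∈ (extChartAt I x₀).source) :
    extendByZero I x₀ Z x = VectorField.mpullback I 𝓘(𝕜, E) (extChartAt I x₀) Z x :=
  if_pos hx

theorem extendByZero_of_notMem_image_tsupport {x₀ x : M} {Z : E → E}
    (hx : x ∉ (extChartAt I x₀).symm '' tsupport Z) : extendByZero I x₀ Z x = 0 := by
  by_cases hxs : x ∈ (extChartAt I x₀).source
  · have hZ : Z (extChartAt I x₀ x) = 0 := image_eq_zero_of_notMem_tsupport fun h =>
      hx ⟨_, h, (extChartAt I x₀).left_inv hxs⟩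
    exact (extendByZero_of_mem_source Z hxs).trans ((congrArg _ hZ).trans (map_zero _))
  · exact if_neg hxs

theorem mfderiv_extChartAt_extendByZero [IsManifold I 1 M] {x₀ x : M} (Z : E → E)
    (hx : x ∈ (extChartAt I x₀).source) :
    mfderiv% (extChartAt I x₀) x (extendByZero I x₀ Z x) = Z (extChartAt I x₀ x) := by
  rw [extendByZero_of_mem_source Z hx]
  exact (isInvertible_mfderiv_extChartAt hx).self_apply_inverse _

theorem isClosed_extChartAt_symm_image_tsupport [T2Space M] {x₀ : M} {Z : E → E}
    (hc : HasCompactSupport Z) (hs : tsupport Z ⊆ (extChartAt I x₀).target) :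
    IsClosed ((extChartAt I x₀).symm '' tsupport Z) :=
  (hc.isCompact.image_of_continuousOn ((continuousOn_extChartAt_symm x₀).mono hs)).isClosed

theorem eventually_extendByZero_eq_zero [T2Space M] {x₀ x : M} {Z : E → E}
    (hc : HasCompactSupport Z) (hs : tsupport Z ⊆ (extChartAt I x₀).target)
    (hx : x ∉ (extChartAt I x₀).source) : ∀ᶠ x' in 𝓝 x, extendByZero I x₀ Z x' = 0 := by
  refine Filter.mem_of_superset
    ((isClosed_extChartAt_symm_image_tsupport hc hs).isOpen_compl.mem_nhds ?_)
    fun _ => extendByZero_of_notMem_image_tsupport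
  rintro ⟨y, hy, rfl⟩
  exact hx ((extChartAt I x₀).map_target (hs hy))

theorem contMDiff_extendByZero [CompleteSpace E] [T2Space M] {m : WithTop ℕ∞}
    [IsManifold I 1 M] [IsManifold I (m + 1) M] {x₀ : M} {Z : E → E} (hZ : ContDiff 𝕜 m Z)
    (hc : HasCompactSupport Z) (hs : tsupport Z ⊆ (extChartAt I x₀).target) :
    ContMDiff I I.tangent m
      (fun x => (⟨x, extendByZero I x₀ Z x⟩ : TangentBundle I M)) := by
  intro x
  by_cases hx : x ∈ (extChartAt I x₀).source
  · have hpullback := ContMDiffAt.mpullback_vectorField_preimage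
      (contMDiffAt_vectorSpace_iff_contDiffAt.2 hZ.contDiffAt)
      (contMDiffAt_extChartAt' (n := m + 1) (by rwa [extChartAt_source] at hx))
      (isInvertible_mfderiv_extChartAt hx) le_rfl
    refine hpullback.congr_of_eventuallyEq ?_
    filter_upwards [(isOpen_extChartAt_source x₀).mem_nhds hx] with x' hx'
    rw [extendByZero_of_mem_source Z hx']
  · refine (Bundle.contMDiff_zeroSection 𝕜
      (TangentSpace I : M → Type _)).contMDiffAt.congr_of_eventuallyEq ?_
    filter_upwards [eventually_extendByZero_eq_zero hc hs hx] with x' hx'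
    rw [hx']
    rfl

end ExtendByZero

section LocalTransitivity

open Filter Topology

variable {n : ℕ} {M : Type*} [TopologicalSpace M] [ChartedSpace (EuclideanSpace ℝ (Fin n)) M]
  [IsManifold (𝓡 n) ∞ M]

namespace VolumeForm

theorem divergence_congr (μ : VolumeForm n M) {X Y : SmoothVectorField n M} {x : M}
    (h : ∀ᶠ x' in 𝓝 x, X x' = Y x') : μ.divergence X x = μ.divergence Y x := by
  have hsymm : Tendsto (extChartAt (𝓡 n) x).symm (𝓝 (extChartAt (𝓡 n) x x)) (𝓝 x) := by
    simpa only [ContinuousAt, extChartAt_to_inv] using continuousAt_extChartAt_symm (I := 𝓡 n) x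
  exact flatDivergence_congr _ ((hsymm.eventually h).mono fun _ hy => congrArg _ hy)

theorem exists_mem_ker_divergence_apply_eq [T2Space M] (hn : 1 < n) (μ : VolumeForm n M)
    {U : Set M} (hU : IsOpen U) {p : M} (hp : p ∈ U) (v : TangentSpace (𝓡 n) p) :
    ∃ X ∈ LinearMap.ker μ.divergence, (∀ x ∉ U, X x = 0) ∧ X p = v := by
  have := SmoothVectorField.isManifold_of_infty n M 1
  have : IsManifold (𝓡 n) (∞ + 1) M := inferInstanceAs (IsManifold (𝓡 n) ∞ M)
  let φ := extChartAt (𝓡 n) p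
  have hpφ : p ∈ φ.source := mem_extChartAt_source p
  have hU' : IsOpen (φ.target ∩ φ.symm ⁻¹' U) :=
    (continuousOn_extChartAt_symm p).isOpen_inter_preimage (isOpen_extChartAt_target p) hU
  obtain ⟨Z, hZ, hc, hs, hdiv, hZp⟩ := exists_flatDivergence_eq_zero_apply_eq (by simpa using hn)
    hU' (fun y hy => (μ.contDiffAt_logDensity hy.1).contDiffWithinAt)
    ⟨φ.map_source hpφ, by rwa [Set.mem_preimage, φ.left_inv hpφ]⟩
    (mfderiv (𝓡 n) (𝓡 n) φ p v)
  have hsφ : tsupport Z ⊆ φ.target := hs.trans Set.inter_subset_left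
  let X : SmoothVectorField n M := ⟨extendByZero (𝓡 n) p Z, contMDiff_extendByZero hZ hc hsφ⟩
  have hXZ {x : M} (hx : x ∈ φ.source) : mfderiv (𝓡 n) (𝓡 n) φ x (X x) = Z (φ x) :=
    mfderiv_extChartAt_extendByZero Z hx
  refine ⟨X, LinearMap.mem_ker.2 (funext fun x => ?_), fun x hx => ?_, ?_⟩
  · by_cases hx : x ∈ φ.source
    · have hev : fieldInChart X p =ᶠ[𝓝 (φ x)] Z := by
        filter_upwards [(isOpen_extChartAt_target p).mem_nhds (φ.map_source hx)] with y hy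
        obtain ⟨x', hx', rfl⟩ := φ.surjOn hy
        exact (fieldInChart_extChartAt X hx').trans (hXZ hx')
      rw [μ.divergence_eq_flatDivergence X hx, flatDivergence_congr _ hev, hdiv, Pi.zero_apply]
    · have hev : ∀ᶠ x' in 𝓝 x, X x' = (0 : SmoothVectorField n M) x' :=
        eventually_extendByZero_eq_zero hc hsφ hx
      rw [μ.divergence_congr hev, map_zero]
  · refine extendByZero_of_notMem_image_tsupport ?_
    rintro ⟨y, hy, rfl⟩
    exact hx (hs hy).2
  · exact (isInvertible_mfderiv_extChartAt hpφ).injective ((hXZ hpφ).trans hZp)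

end VolumeForm

end LocalTransitivity

section Codimension

theorem exists_seq_isOpen_mem_iff {α : Type*} [TopologicalSpace α] [T2Space α] {s : Set α}
    (hs : s.Infinite) : ∃ (p : ℕ → α) (U : ℕ → Set α),
      (∀ i, p i ∈ s) ∧ (∀ i, IsOpen (U i)) ∧ ∀ i j, p j ∈ U i ↔ i = j := by
  have := hs.to_subtype
  obtain ⟨f, hf⟩ := exists_topology_isEmbedding_nat s
  have hemb : Topology.IsEmbedding fun i => (f i : α) := .comp .subtypeVal hf
  choose U hU hpre using fun i => hemb.isOpen_iff.1 (isOpen_discrete ({i} : Set ℕ))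
  refine ⟨fun i => f i, U, fun i => (f i).2, hU, fun i j => ?_⟩
  rw [← Set.mem_preimage (f := fun i => (f i : α)), hpre, Set.mem_singleton_iff, eq_comm]

variable {n : ℕ} {M : Type*} [TopologicalSpace M] [T2Space M]
  [ChartedSpace (EuclideanSpace ℝ (Fin n)) M] [IsManifold (𝓡 n) ∞ M]

namespace VolumeForm

theorem exists_mem_ker_divergence_bracket_ne_zero (hn : 1 < n) (μ : VolumeForm n M)
    (Y : SmoothVectorField n M) {U : Set M} (hU : IsOpen U) {p : M} (hp : p ∈ U)
    (hY : mvfderiv (𝓡 n) (μ.divergence Y) p ≠ 0) :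
    ∃ X ∈ LinearMap.ker μ.divergence,
      (∀ x ∉ U, μ.divergence ⁅X, Y⁆ x = 0) ∧ μ.divergence ⁅X, Y⁆ p ≠ 0 := by
  obtain ⟨v, hv⟩ := DFunLike.ne_iff.1 hY
  obtain ⟨X, hX, hXU, rfl⟩ := μ.exists_mem_ker_divergence_apply_eq hn hU hp v
  refine ⟨X, hX, fun x hx => ?_, by rwa [μ.divergence_bracket_of_mem_ker hX]⟩
  rw [μ.divergence_bracket_of_mem_ker hX, hXU x hx, map_zero]

theorem infinite_setOf_mvfderiv_divergence_ne_zero (hn : 1 < n) [ConnectedSpace M]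
    (μ : VolumeForm n M) {Y : SmoothVectorField n M} (hY : Y ∉ conformalFields μ) :
    {x | mvfderiv (𝓡 n) (μ.divergence Y) x ≠ 0}.Infinite := by
  obtain ⟨p, hp⟩ : ∃ p, mvfderiv (𝓡 n) (μ.divergence Y) p ≠ 0 := by
    contrapose! hY
    exact μ.mem_conformalFields_of_mvfderiv_eq_zero hY
  obtain ⟨X, hX, -, hXp⟩ :=
    μ.exists_mem_ker_divergence_bracket_ne_zero hn Y isOpen_univ (Set.mem_univ p) hp
  have hopen : IsOpen {x | μ.divergence ⁅X, Y⁆ x ≠ 0} :=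
    isOpen_ne_fun (μ.contMDiff_divergence _).continuous continuous_const
  have : Nontrivial (EuclideanSpace ℝ (Fin n)) :=
    Module.nontrivial_of_finrank_pos (R := ℝ) (by simpa using hn.pos)
  refine (infinite_of_isOpen_of_nonempty_of_chartedSpace (EuclideanSpace ℝ (Fin n)) hopen
    ⟨p, hXp⟩).mono fun x (hx : μ.divergence ⁅X, Y⁆ x ≠ 0) hx0 => hx ?_
  rw [μ.divergence_bracket_of_mem_ker hX, hx0, zero_apply]

theorem exists_seq_divergence_bracket_ne_zero_iff (hn : 1 < n) [ConnectedSpace M]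
    (μ : VolumeForm n M) {Y : SmoothVectorField n M} (hY : Y ∉ conformalFields μ) :
    ∃ (X : ℕ → SmoothVectorField n M) (p : ℕ → M), (∀ i, X i ∈ LinearMap.ker μ.divergence) ∧
      ∀ i j, μ.divergence ⁅X i, Y⁆ (p j) ≠ 0 ↔ i = j := by
  obtain ⟨p, U, hp, hU, hpU⟩ :=
    exists_seq_isOpen_mem_iff (μ.infinite_setOf_mvfderiv_divergence_ne_zero hn hY)
  choose X hX hoff hne using fun i =>
    μ.exists_mem_ker_divergence_bracket_ne_zero hn Y (hU i) ((hpU i i).2 rfl) (hp i)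
  refine ⟨X, p, hX, fun i j => ⟨fun h => (hpU i j).1 ?_, ?_⟩⟩
  · exact not_imp_comm.1 (hoff i (p j)) h
  · rintro rfl
    exact hne i

end VolumeForm

theorem mainTheorem7_general (hn : 1 < n) [ConnectedSpace M] (μ : VolumeForm n M)
    (V : Submodule ℝ (SmoothVectorField n M))
    (hV : ∀ X ∈ LinearMap.ker μ.divergence, ∀ Y ∈ V, ⁅X, Y⁆ ∈ V)
    [FiniteDimensional ℝ (V ⧸ (conformalFields μ).submoduleOf V)] :
    V ≤ conformalFields μ := by
  intro Y hYV
  by_contra hY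
  obtain ⟨X, p, hX, hXp⟩ := μ.exists_seq_divergence_bracket_ne_zero_iff hn hY
  let divAt : V →ₗ[ℝ] ℕ → ℝ := LinearMap.funLeft ℝ ℝ p ∘ₗ μ.divergence ∘ₗ V.subtype
  have hconst : ∀ Z ∈ (conformalFields μ).submoduleOf V, ∀ i j, divAt Z i = divAt Z j := by
    intro Z hZ i j
    obtain ⟨c, hc⟩ := (μ.mem_conformalFields_iff _).1 hZ
    exact (hc (p i)).trans (hc (p j)).symm
  have hindep := linearIndependent_mkQ_of_apply_ne_zero_iff divAt hconst
    (v := fun i => ⟨⁅X i, Y⁆, hV (X i) (hX i) Y hYV⟩) hXp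
  exact not_finite_iff_infinite.2 inferInstance hindep.finite

end Codimension

theorem mainTheorem7 {n : ℕ} (hn : 1 < n)
    (M : Type*) [TopologicalSpace M] [T2Space M] [ConnectedSpace M]
    [ChartedSpace (EuclideanSpace ℝ (Fin n)) M] [IsManifold (𝓡 n) ∞ M]
    (μ : VolumeForm n M) :
    ¬ ∃ 𝔤 : LieSubalgebra ℝ (SmoothVectorField n M),
      conformalFields μ < 𝔤.toSubmodule ∧
      FiniteDimensional ℝ
        (𝔤.toSubmodule ⧸ (conformalFields μ).submoduleOf 𝔤.toSubmodule) := by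
  rintro ⟨𝔤, hlt, hfin⟩
  exact hlt.not_ge (mainTheorem7_general hn μ 𝔤.toSubmodule fun X hX Y hY =>
    𝔤.lie_mem (hlt.le (μ.ker_divergence_le_conformalFields hX)) hY)
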